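/- Let $p$ be a prime, $h\ge 1$ an integer and $q=p^h$. Let $K$ be a field of characteristic $p$ (for instance $\mathbb{F}_{q^2}$ or its algebraic closure) and let $\omega\in K$ satisfy $\omega^{q-1}=-1$. Consider the two affine plane curves $$\sum_{i=1}^{h}Y^{q/p^i}+\omega X^{q+1}=0\quad(\text{where } h\ge 2),\qquad \sum_{i=1}^{h}Y^{q/p^i}+\omega X^{(q+1)/d}=0\quad(\text{where } d\ge 1,\ d\mid q+1).$$ Each of these curves is irreducible over $K$, its projective closure in $\mathbb{P}^2$ has exactly one $K$-rational point on the line at infinity, and exactly one place $P_\infty$ of its function field $K(x,y)$ is centred at that point. The Weierstrass semigroup at $P_\infty$, $$H(P_\infty)=\{n\in\mathbb{Z}_{\ge 0} : \text{there is } f\in K(x,y) \text{ with pole divisor } nP_\infty\},$$ is generated (as a submonoid of $\mathbb{Z}_{\ge 0}$) by $q/p$ and $q+1$ for the first curve, and by $q/p$ and $(q+1)/d$ for the second curve. -/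

import Mathlib

/-! ### Places of a function field and Weierstrass semigroups -/

/-- A place of the field extension `F / K`, given by its valuation ring: a proper valuation
subring of `F` that contains the constants `K`. -/
structure Place (K F : Type*) [Field K] [Field F] [Algebra K F] where
  ring : ValuationSubring F
  algebraMap_mem : ∀ c : K, algebraMap K F c ∈ ring
  ne_top : ring ≠ ⊤

namespace Place

variable {K F : Type*} [Field K] [Field F] [Algebra K F]

/-- `t` is a local parameter at `P`: it generates the maximal ideal of the valuation ring. -/
def IsLocalParameter (P : Place K F) (t : F) : Prop :=
  ∃ ht : t ∈ P.ring,
    IsLocalRing.maximalIdeal P.ring = Ideal.span {(⟨t, ht⟩ : P.ring)}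

/-- `ord_P(f) = -n`: for some local parameter `t` at `P`, the function `f * t ^ n` is a unit of
the valuation ring. -/
def HasPoleOrder (P : Place K F) (f : F) (n : ℕ) : Prop :=
  ∃ t : F, P.IsLocalParameter t ∧ P.ring.valuation (f * t ^ n) = 1

/-- The Weierstrass semigroup at `P`: all `n` such that some `f` has pole divisor `n P`, that is,
`f` is regular at all other places and `ord_P(f) = -n`. -/
def weierstrassSemigroup (P : Place K F) : Set ℕ :=
  {n | ∃ f : F, (∀ Q : Place K F, Q ≠ P → f ∈ Q.ring) ∧ P.HasPoleOrder f n}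

end Place

/-! ### Affine plane curves, their points at infinity and their function fields -/

namespace PlaneCurve

variable {K : Type*} [Field K]

/-- The homogenization of `f(X, Y)` in the variables `X`, `Y`, `Z` (indices `0`, `1`, `2`). -/
noncomputable def homogenization (f : MvPolynomial (Fin 2) K) : MvPolynomial (Fin 3) K :=
  ∑ i ∈ Finset.range (f.totalDegree + 1),
    MvPolynomial.rename Fin.castSucc (MvPolynomial.homogeneousComponent i f) *
      MvPolynomial.X 2 ^ (f.totalDegree - i)

/-- A point of the projective plane that lies on the projective closure of `f = 0` and on the
line at infinity `Z = 0`. -/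
def IsPointAtInfinity (f : MvPolynomial (Fin 2) K)
    (pt : Projectivization K (Fin 3 → K)) : Prop :=
  MvPolynomial.eval pt.rep (homogenization f) = 0 ∧ pt.rep 2 = 0

/-- The coordinate ring `K[X, Y] / (f)`. -/
abbrev CoordinateRing (f : MvPolynomial (Fin 2) K) : Type _ :=
  MvPolynomial (Fin 2) K ⧸ Ideal.span {f}

/-- The function field `K(x, y)` with `f(x, y) = 0`; it is a field once the coordinate ring is
a domain. -/
abbrev FunctionField (f : MvPolynomial (Fin 2) K) : Type _ :=
  FractionRing (CoordinateRing f)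

/-- The coordinate function `x` (for `i = 0`) or `y` (for `i = 1`). -/
noncomputable def coord (f : MvPolynomial (Fin 2) K) (i : Fin 2) : FunctionField f :=
  algebraMap (CoordinateRing f) (FunctionField f)
    (Ideal.Quotient.mk (Ideal.span {f}) (MvPolynomial.X i))

/-- The place `P` is centred at the point `pt` of the projective plane: after multiplication by
some function `c`, the homogeneous coordinate functions `(x : y : 1)` are regular at `P`
and take there the values given by the homogeneous coordinates of `pt`. -/
def IsCentredAt (f : MvPolynomial (Fin 2) K) [IsDomain (CoordinateRing f)]
    (P : Place K (FunctionField f)) (pt : Projectivization K (Fin 3 → K)) : Prop :=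
  ∃ c : FunctionField f, ∀ i : Fin 3,
    P.ring.valuation
      (c * ![coord f 0, coord f 1, 1] i - algebraMap K (FunctionField f) (pt.rep i)) < 1

/-- The curve `f = 0` is irreducible, its projective closure has a unique point at infinity,
there is a unique place centred at that point, and the Weierstrass semigroup at that place
is `S`. -/
def HasWeierstrassSemigroupAtInfinity (f : MvPolynomial (Fin 2) K) (S : AddSubmonoid ℕ) : Prop :=
  ∃ _ : IsDomain (CoordinateRing f), ∃ pt : Projectivization K (Fin 3 → K),
    (∀ pt', IsPointAtInfinity f pt' ↔ pt' = pt) ∧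
    ∃ P : Place K (FunctionField f),
      (∀ Q : Place K (FunctionField f), IsCentredAt f Q pt ↔ Q = P) ∧
      P.weierstrassSemigroup = (S : Set ℕ)

/-- The polynomial `∑_{i=1}^h Y^{q/p^i} + ω X^m`, where `q = p^h`. -/
noncomputable def traceCurve (p h : ℕ) (ω : K) (m : ℕ) : MvPolynomial (Fin 2) K :=
  (∑ i ∈ Finset.Icc 1 h, MvPolynomial.X 1 ^ (p ^ h / p ^ i)) +
    MvPolynomial.C ω * MvPolynomial.X 0 ^ m

end PlaneCurve

/-! Put `T(Y) = ∑ Y^(q/p^i)` and `n = deg T = q/p`. The exponent `m` of `X` divides `q + 1`, so it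
is coprime to `n`; and `T' = 1`, since in characteristic `p` only the linear term of `T` has a
nonzero derivative. The argument works for any separated curve `T(y) + ω x^m = 0` with these
properties, apart from a normalization when `n = m = 1`.

Let `v` be a valuation that is trivial on `K` and for which `x` has a pole. The equation forces
`v(x)^m = v(y)^n`, so by Bézout `v(x) = γ^n` and `v(y) = γ^m`, where `γ > 1` is the value of a fixed
monomial `s = x^a y^b`. The monomials `x^i y^j` with `j < n` then have pairwise distinct values, so
`v` of a nonzero polynomial of `Y`-degree below `n` is `γ` to its weighted degree
(`Valuation.map_aevalAeval_eq_pow_weightedDegree`). Division by the monic equation reduces every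
element of the coordinate ring to such a polynomial. Hence the coordinate ring is a domain, at most
one place is a pole of `x`, `s⁻¹` is a local parameter there, and the pole orders of nonzero regular
functions lie in the monoid generated by `n` and `m`.

It remains to see that functions regular away from this place lie in the coordinate ring. Since `T'
= 1`, the discriminant of `y` over `K[x]` is `±1`, so the coordinate ring is integrally closed
(`IsIntegrallyClosed.of_adjoin_eq_top_of_derivative_eq_one`), and an integrally closed domain is the
intersection of the valuation rings above it (`forall_mem_ring_iff`). The point at infinity is read
off the top homogeneous component, according to which of `n` and `m` is larger. -/

open Polynomial

/-! ### Valuations of polynomials in two elements of coprime weights -/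

/-- The weighted degree of `p(X, Y)` for the weights `n` of `X` and `m` of `Y`. -/
noncomputable def Polynomial.weightedDegree {K : Type*} [Semiring K] (n m : ℕ) (p : K[X][X]) : ℕ :=
  p.support.sup fun j ↦ (p.coeff j).natDegree * n + j * m

theorem Polynomial.weightedDegree_mem_closure {K : Type*} [Semiring K] (n m : ℕ) (p : K[X][X]) :
    p.weightedDegree n m ∈ AddSubmonoid.closure {n, m} := by
  rcases p.support.eq_empty_or_nonempty with h0 | h0
  · simp [weightedDegree, h0]
  · obtain ⟨j, -, hj⟩ :=
      p.support.exists_mem_eq_sup h0 fun j ↦ (p.coeff j).natDegree * n + j * m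
    rw [weightedDegree, hj]
    refine add_mem ?_ ?_ <;> rw [← smul_eq_mul] <;>
      exact AddSubmonoid.nsmul_mem _ (AddSubmonoid.subset_closure (by simp)) _

/-- If `v x = γ ^ n` and `v y = γ ^ m` with `γ > 1` and coprime `n` and `m`, then the valuation of
`p(x, y)` is determined by the weighted degree of `p`, as long as the degree of `p` in `Y` is less
than `n`. -/
theorem Valuation.map_aevalAeval_eq_pow_weightedDegree {K L Γ : Type*} [Field K] [Field L]
    [Algebra K L] [LinearOrderedCommGroupWithZero Γ] (v : Valuation L Γ) [v.IsTrivialOn K]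
    {n m : ℕ} (hnm : n.Coprime m) {x y : L} {γ : Γ} (hγ : 1 < γ) (hx : v x = γ ^ n)
    (hy : v y = γ ^ m) {p : K[X][X]} (hp : p ≠ 0) (hpn : p.natDegree < n) :
    v (aevalAeval x y p) = γ ^ p.weightedDegree n m := by
  have hx1 : 1 < v x := hx ▸ one_lt_pow₀ hγ (by omega)
  have hterm : ∀ j ∈ p.support, v (aeval x (p.coeff j) * y ^ j) =
      γ ^ ((p.coeff j).natDegree * n + j * m) := by
    intro j hj
    rw [map_mul, map_pow, valuation_aeval_eq_valuation_X_pow_natDegree_of_one_lt_valuation_X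
      x hx1 (mem_support_iff.mp hj), hx, hy, ← pow_mul, ← pow_mul, ← pow_add]
    ring_nf
  have hsum : aevalAeval x y p = ∑ j ∈ p.support, aeval x (p.coeff j) * y ^ j := by
    conv_lhs => rw [p.as_sum_support_C_mul_X_pow]
    simp
  obtain ⟨j, hj, hjmax⟩ := p.support.exists_mem_eq_sup (by simpa using hp)
    fun j ↦ (p.coeff j).natDegree * n + j * m
  rw [weightedDegree, hjmax, hsum, ← hterm j hj]
  refine v.map_sum_eq_of_lt hj fun i hi ↦ ?_
  rw [Finset.mem_sdiff, Finset.mem_singleton] at hi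
  rw [hterm i hi.1, hterm j hj]
  refine pow_lt_pow_right₀ hγ (lt_of_le_of_ne ?_ fun heq ↦ hi.2 ?_)
  · exact (Finset.le_sup (f := fun j ↦ (p.coeff j).natDegree * n + j * m) hi.1).trans_eq hjmax
  -- Two terms of equal weight satisfy `i m ≡ j m` modulo `n`; coprimality and `i, j < n` give `i =
  -- j`. So the maximal term is strictly dominant.
  · have hin := (le_natDegree_of_mem_supp i hi.1).trans_lt hpn
    have hjn := (le_natDegree_of_mem_supp j hj).trans_lt hpn
    have hmod : i * m ≡ j * m [MOD n] := by
      have := congrArg (· % n) heq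
      simpa [Nat.ModEq] using this
    exact (Nat.ModEq.cancel_right_of_coprime hnm hmod).eq_of_lt_of_lt hin hjn

/-- If `v x ^ m = v y ^ n` and `a n + b m = 1`, then `v x` and `v y` are powers of the valuation
of `x ^ a * y ^ b`. -/
theorem Valuation.eq_pow_of_pow_eq_pow {L Γ : Type*} [Field L] [LinearOrderedCommGroupWithZero Γ]
    (v : Valuation L Γ) {n m : ℕ} {a b : ℤ} (hab : a * n + b * m = 1) (hn : n ≠ 0) {x y : L}
    (hx : 1 < v x) (hxy : v x ^ m = v y ^ n) :
    1 < v (x ^ a * y ^ b) ∧ v x = v (x ^ a * y ^ b) ^ n ∧ v y = v (x ^ a * y ^ b) ^ m := by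
  have hx0 : v x ≠ 0 := (zero_lt_one.trans hx).ne'
  have hy0 : v y ≠ 0 := by
    intro h
    rw [h, zero_pow hn] at hxy
    exact pow_ne_zero m hx0 hxy
  have hxn : v x = v (x ^ a * y ^ b) ^ n := by
    have e : v y ^ (b * n) = v x ^ (b * m) := by
      rw [mul_comm b, mul_comm b, zpow_mul, zpow_mul, zpow_natCast, zpow_natCast, hxy]
    rw [map_mul, map_zpow₀, map_zpow₀, mul_pow, ← zpow_natCast, ← zpow_natCast, ← zpow_mul,
      ← zpow_mul, e, ← zpow_add₀ hx0, hab, zpow_one]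
  have hyn : v y = v (x ^ a * y ^ b) ^ m := by
    have e : v x ^ (a * m) = v y ^ (a * n) := by
      rw [mul_comm a, mul_comm a, zpow_mul, zpow_mul, zpow_natCast, zpow_natCast, hxy]
    rw [map_mul, map_zpow₀, map_zpow₀, mul_pow, ← zpow_natCast, ← zpow_natCast, ← zpow_mul,
      ← zpow_mul, e, ← zpow_add₀ hy0, hab, zpow_one]
  refine ⟨?_, hxn, hyn⟩
  by_contra! hle
  exact hx.not_ge (hxn ▸ pow_le_one₀ zero_le hle)

/-! ### Places -/

/-- An element of a field extension of `K` that is transcendental over `K` lies outside some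
valuation ring containing `K`. -/
theorem Transcendental.exists_valuationSubring_notMem {K L : Type*} [Field K] [Field L]
    [Algebra K L] {x : L} (hx : Transcendental K x) :
    ∃ V : ValuationSubring L, (∀ c : K, algebraMap K L c ∈ V) ∧ x ∉ V := by
  -- The integral closure of `K` in `L` is the intersection of the valuation rings above it, and it
  -- misses the transcendental `x`.
  have : IsIntegrallyClosedIn (integralClosure K L).toSubring L :=
    inferInstanceAs (IsIntegrallyClosedIn (integralClosure K L) L)
  obtain ⟨V, hV, hxV⟩ := Subring.exists_le_valuationSubring_of_isIntegrallyClosedIn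
    (x := x) (R := (integralClosure K L).toSubring) fun h ↦ hx (IsIntegral.isAlgebraic h)
  exact ⟨V, fun c ↦ hV ((integralClosure K L).algebraMap_mem c), hxV⟩

theorem ValuationSubring.isTrivialOn_valuation {K L : Type*} [Field K] [Field L] [Algebra K L]
    {V : ValuationSubring L} (hV : ∀ c : K, algebraMap K L c ∈ V) : V.valuation.IsTrivialOn K where
  eq_one c hc := by
    refine le_antisymm ((V.valuation_le_one_iff _).mpr (hV c)) ?_
    have h := (V.valuation_le_one_iff _).mpr (hV c⁻¹)
    rw [map_inv₀, map_inv₀] at h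
    exact (inv_le_one₀ (zero_lt_iff.mpr (by simpa using hc))).mp h

/-- The valuations of two elements `x`, `y` with `T(y) + ω x ^ m = 0` at a valuation ring not
containing `x`. -/
theorem Valuation.pow_eq_pow_of_aeval_add_eq_zero {K L Γ : Type*} [Field K] [Field L]
    [Algebra K L] [LinearOrderedCommGroupWithZero Γ] (v : Valuation L Γ) [hv : v.IsTrivialOn K]
    {T : K[X]} {ω : K} (hω : ω ≠ 0) {m : ℕ} {x y : L}
    (hxy : aeval y T + algebraMap K L ω * x ^ m = 0) (hT : T ≠ 0) (hy : 1 < v y) :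
    v x ^ m = v y ^ T.natDegree := by
  rw [← valuation_aeval_eq_valuation_X_pow_natDegree_of_one_lt_valuation_X y hy hT,
    eq_neg_of_add_eq_zero_left hxy, v.map_neg, map_mul, map_pow, hv.eq_one ω hω, one_mul]

/-- A pole of `y` makes the leading term of `T(y)` dominate, which forces a pole of `x`; if `y` is
regular then so is `T(y) = -ω x ^ m`, hence `x`. Being at infinity can thus be tested on `x` alone.
-/
theorem ValuationSubring.mem_iff_mem_of_aeval_add_eq_zero {K L : Type*} [Field K] [Field L]
    [Algebra K L] {V : ValuationSubring L} (hV : ∀ c : K, algebraMap K L c ∈ V)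
    {T : K[X]} {ω : K} (hω : ω ≠ 0) {m : ℕ} (hm : m ≠ 0) {x y : L}
    (hxy : aeval y T + algebraMap K L ω * x ^ m = 0) (hT : T.natDegree ≠ 0) :
    x ∈ V ↔ y ∈ V := by
  have := V.isTrivialOn_valuation hV
  have hT0 : T ≠ 0 := by rintro rfl; simp at hT
  rw [← V.valuation_le_one_iff, ← V.valuation_le_one_iff]
  constructor
  · intro hx
    by_contra! hy
    have h := V.valuation.pow_eq_pow_of_aeval_add_eq_zero hω hxy hT0 hy
    exact (one_lt_pow₀ hy hT).not_ge (h ▸ pow_le_one₀ zero_le hx)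
  · intro hy
    by_contra! hx
    have hTy : V.valuation (aeval y T) ≤ 1 := by
      rw [V.valuation_le_one_iff] at hy ⊢
      rw [aeval_eq_sum_range]
      refine sum_mem fun i _ ↦ ?_
      rw [Algebra.smul_def]
      exact V.mul_mem _ _ (hV _) (pow_mem hy i)
    rw [eq_neg_of_add_eq_zero_left hxy, Valuation.map_neg, map_mul, map_pow,
      Valuation.IsTrivialOn.eq_one ω hω, one_mul] at hTy
    exact (one_lt_pow₀ hx hm).not_ge hTy

/-! ### Simple étale extensions of integrally closed domains -/

section IntegrallyClosed

variable {R B : Type*} [CommRing R] [IsDomain R] [IsIntegrallyClosed R] [CommRing B]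
  [Algebra R B] {y : B}

/-- The discriminant of the power basis of `y` multiplies every integral element into `R[y]`. Up to
sign it is the norm of `g'(y) = 1`, where `g` is the minimal polynomial of `y`, so it is a unit. -/
theorem IsIntegral.mem_range_algebraMap_of_derivative_minpoly_eq_one (k F : Type*) [Field k]
    [Field F] [Algebra R k] [IsFractionRing R k] [Algebra B F] [IsFractionRing B F] [Algebra k F]
    [Algebra R F] [IsScalarTower R k F] [IsScalarTower R B F]
    (hy : IsIntegral R y) (hadj : Algebra.adjoin R {y} = ⊤)
    (hder : derivative (minpoly R y) = 1) {z : F} (hz : IsIntegral R z) :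
    ∃ b : B, algebraMap B F b = z := by
  have hy' : IsIntegral R (algebraMap B F y) := hy.map (IsScalarTower.toAlgHom R B F)
  have hyk : IsIntegral k (algebraMap B F y) := hy'.tower_top
  have hB : ∀ b : B, algebraMap B F b ∈ Algebra.adjoin R {algebraMap B F y} := by
    intro b
    have hb : b ∈ Algebra.adjoin R {y} := by rw [hadj]; exact Algebra.mem_top
    have := Subalgebra.mem_map.mpr ⟨b, hb, (rfl : IsScalarTower.toAlgHom R B F b = _)⟩
    rwa [AlgHom.map_adjoin, Set.image_singleton] at this
  have hle : Algebra.adjoin R {algebraMap B F y} ≤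
      (IntermediateField.adjoin k {algebraMap B F y}).toSubalgebra.restrictScalars R :=
    Algebra.adjoin_le (Set.singleton_subset_iff.mpr
      (IntermediateField.mem_adjoin_simple_self k (algebraMap B F y)))
  have htop : IntermediateField.adjoin k {algebraMap B F y} = ⊤ := by
    rw [eq_top_iff]
    intro z _
    obtain ⟨a, b, -, rfl⟩ := IsFractionRing.div_surjective (A := B) z
    exact div_mem (hle (hB a)) (hle (hB b))
  have hmin : minpoly k (algebraMap B F y) = (minpoly R y).map (algebraMap R k) := by
    rw [minpoly.isIntegrallyClosed_eq_field_fractions' k hy',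
      minpoly.algebraMap_eq (IsFractionRing.injective B F)]
  have hder' : derivative (minpoly k (algebraMap B F y)) = 1 := by
    rw [hmin, derivative_map, hder, Polynomial.map_one]
  have hsep : IsSeparable k (algebraMap B F y) := by
    rw [IsSeparable, separable_def, hder']
    exact isCoprime_one_right
  obtain ⟨pb, hpb⟩ : ∃ pb : PowerBasis k F, pb.gen = algebraMap B F y :=
    ⟨PowerBasis.ofAdjoinEqTop hyk <| by
      rw [← IntermediateField.adjoin_simple_toSubalgebra_of_isAlgebraic hyk.isAlgebraic, htop]
      rfl, PowerBasis.ofAdjoinEqTop_gen _ _⟩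
  have : FiniteDimensional k F := pb.finite
  have : Algebra.IsSeparable k F := by
    have h1 : Algebra.IsSeparable k (IntermediateField.adjoin k {algebraMap B F y}) :=
      (IntermediateField.isSeparable_adjoin_simple_iff_isSeparable k F).mpr hsep
    rw [htop] at h1
    exact Algebra.IsSeparable.of_algHom k (⊤ : IntermediateField k F)
      (IntermediateField.topEquiv (F := k) (E := F)).symm.toAlgHom
  have hdisc : Algebra.discr k pb.basis = (-1) ^ (pb.dim * (pb.dim - 1) / 2) := by
    rw [Algebra.discr_powerBasis_eq_norm, hpb, hder']
    simp [PowerBasis.finrank pb]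
  have hmem := Algebra.discr_mul_isIntegral_mem_adjoin k (B := pb) (by rwa [hpb]) hz
  rw [hdisc, hpb] at hmem
  have hz' : z ∈ Algebra.adjoin R {algebraMap B F y} := by
    rcases neg_one_pow_eq_or k (pb.dim * (pb.dim - 1) / 2) with h | h <;> simpa [h] using hmem
  exact (Algebra.adjoin_le (S := (IsScalarTower.toAlgHom R B F).range)
    (by simp)) hz'

/-- If `B = R[y]` for an integral `y` whose minimal polynomial `g` over the integrally closed domain
`R` has derivative `1`, then `B` is integrally closed. -/
theorem IsIntegrallyClosed.of_adjoin_eq_top_of_derivative_eq_one [IsDomain B] [FaithfulSMul R B]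
    (hy : IsIntegral R y) (hadj : Algebra.adjoin R {y} = ⊤)
    (hder : derivative (minpoly R y) = 1) : IsIntegrallyClosed B := by
  let : Algebra (FractionRing R) (FractionRing B) := FractionRing.liftAlgebra R (FractionRing B)
  have : IsScalarTower R (FractionRing R) (FractionRing B) :=
    FractionRing.isScalarTower_liftAlgebra R (FractionRing B)
  have : Algebra.IsIntegral R B := by
    refine ⟨fun b ↦ ?_⟩
    have hb : b ∈ Algebra.adjoin R {y} := by rw [hadj]; exact Algebra.mem_top
    exact (Algebra.adjoin_le (S := integralClosure R B)
      (Set.singleton_subset_iff.mpr hy)) hb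
  exact (isIntegrallyClosed_iff (FractionRing B)).mpr fun {z} hz ↦
    hy.mem_range_algebraMap_of_derivative_minpoly_eq_one (FractionRing R) (FractionRing B) hadj hder
      (isIntegral_trans z hz)

end IntegrallyClosed

theorem Polynomial.map_aevalAeval {K A B : Type*} [CommRing K] [CommRing A] [CommRing B]
    [Algebra K A] [Algebra K B] (φ : A →ₐ[K] B) (x y : A) (p : K[X][X]) :
    φ (aevalAeval x y p) = aevalAeval (φ x) (φ y) p := by
  have h : φ.comp (aevalAeval x y) = aevalAeval (φ x) (φ y) := by
    ext <;> simp
  exact DFunLike.congr_fun h p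

/-! ### Curves with separated variables -/

namespace PlaneCurve

section Separated

variable {K : Type*} [Field K]

/-- The polynomial `T(Y) + ω X ^ m`. -/
noncomputable def separatedCurve (T : K[X]) (ω : K) (m : ℕ) : MvPolynomial (Fin 2) K :=
  aeval (MvPolynomial.X 1) T + MvPolynomial.C ω * MvPolynomial.X 0 ^ m

/-- The polynomial `T(Y) + ω X ^ m` as a polynomial in `Y` over `K[X]`. -/
noncomputable def bivariateSeparated (T : K[X]) (ω : K) (m : ℕ) : K[X][X] :=
  T.map C + C (C ω * X ^ m)

variable {T : K[X]} {ω : K} {m : ℕ}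

theorem aevalAeval_bivariateSeparated {A : Type*} [CommRing A] [Algebra K A] (x y : A) :
    aevalAeval x y (bivariateSeparated T ω m) = aeval y T + algebraMap K A ω * x ^ m := by
  have h : aevalAeval x y (T.map C) = aeval y T := by
    rw [← Bivariate.swap_C, Bivariate.aevalAeval_swap, aevalAeval_C]
  rw [bivariateSeparated, map_add, h]
  simp

theorem natDegree_bivariateSeparated : (bivariateSeparated T ω m).natDegree = T.natDegree := by
  rw [bivariateSeparated, natDegree_add_C, natDegree_map_eq_of_injective C_injective]

theorem monic_bivariateSeparated (hT : T.Monic) (hT0 : T.natDegree ≠ 0) :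
    (bivariateSeparated T ω m).Monic := by
  refine (hT.map C).add_of_left (degree_C_le.trans_lt ?_)
  rw [degree_map_eq_of_injective C_injective]
  exact natDegree_pos_iff_degree_pos.mp (Nat.pos_of_ne_zero hT0)

theorem derivative_bivariateSeparated (hT : derivative T = 1) :
    derivative (bivariateSeparated T ω m) = 1 := by
  rw [bivariateSeparated, derivative_add, derivative_C, add_zero, derivative_map, hT,
    Polynomial.map_one]

/-- The coordinate functions in the coordinate ring. -/
noncomputable def ringCoord (f : MvPolynomial (Fin 2) K) (i : Fin 2) : CoordinateRing f :=
  Ideal.Quotient.mk (Ideal.span {f}) (MvPolynomial.X i)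

theorem algebraMap_ringCoord (f : MvPolynomial (Fin 2) K) (i : Fin 2) :
    algebraMap (CoordinateRing f) (FunctionField f) (ringCoord f i) = coord f i := rfl

theorem ringCoord_relation : aeval (ringCoord (separatedCurve T ω m) 1) T +
    algebraMap K _ ω * ringCoord (separatedCurve T ω m) 0 ^ m = 0 := by
  have h : Ideal.Quotient.mkₐ K (Ideal.span {separatedCurve T ω m}) (separatedCurve T ω m) = 0 :=
    Ideal.Quotient.eq_zero_iff_mem.mpr (Ideal.mem_span_singleton_self _)
  conv at h => enter [1, 2]; rw [separatedCurve]
  rw [map_add, ← aeval_algHom_apply, map_mul, map_pow, ← MvPolynomial.algebraMap_eq,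
    AlgHom.commutes] at h
  exact h

theorem exists_aevalAeval_ringCoord_eq (f : MvPolynomial (Fin 2) K) (a : CoordinateRing f) :
    ∃ p : K[X][X], aevalAeval (ringCoord f 0) (ringCoord f 1) p = a := by
  obtain ⟨b, rfl⟩ := Ideal.Quotient.mkₐ_surjective K _ a
  induction b using MvPolynomial.induction_on with
  | C c => exact ⟨C (C c), by simp [← MvPolynomial.algebraMap_eq]⟩
  | add p q hp hq =>
    obtain ⟨p', hp⟩ := hp
    obtain ⟨q', hq⟩ := hq
    exact ⟨p' + q', by rw [map_add, hp, hq, map_add]⟩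
  | mul_X p i hp =>
    obtain ⟨p', hp⟩ := hp
    fin_cases i
    · exact ⟨p' * C X, by rw [map_mul, hp, map_mul, aevalAeval_X]; rfl⟩
    · exact ⟨p' * X, by rw [map_mul, hp, map_mul, aevalAeval_Y]; rfl⟩

/-- Division with remainder in `K[X][Y]` by the equation of the curve, which is monic in `Y`. -/
theorem exists_natDegree_lt_aevalAeval_ringCoord_eq (hT : T.Monic) (hT0 : T.natDegree ≠ 0)
    (a : CoordinateRing (separatedCurve T ω m)) :
    ∃ p : K[X][X], p.natDegree < T.natDegree ∧ aevalAeval (ringCoord (separatedCurve T ω m) 0)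
      (ringCoord (separatedCurve T ω m) 1) p = a := by
  obtain ⟨p, rfl⟩ := exists_aevalAeval_ringCoord_eq _ a
  have hmon := monic_bivariateSeparated (ω := ω) (m := m) hT hT0
  refine ⟨p %ₘ bivariateSeparated T ω m, ?_, ?_⟩
  · rw [← natDegree_bivariateSeparated (ω := ω) (m := m)]
    refine natDegree_modByMonic_lt p hmon fun h ↦ hT0 ?_
    rw [← natDegree_bivariateSeparated (ω := ω) (m := m), h, natDegree_one]
  · conv_rhs => rw [← modByMonic_add_div p (bivariateSeparated T ω m)]
    rw [map_add, map_mul, aevalAeval_bivariateSeparated, ringCoord_relation, zero_mul, add_zero]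

/-- If `T(y) + ω x ^ m = 0`, then the valuations of `x` and `y` at all valuation rings not containing
`x` are powers of the valuation of one and the same element `s`. -/
theorem exists_forall_valuation_eq_pow {L : Type*} [Field L] [Algebra K L] (hω : ω ≠ 0)
    (hm : m ≠ 0) (hT0 : T.natDegree ≠ 0) (hcop : T.natDegree.Coprime m) {x y : L}
    (hxy : aeval y T + algebraMap K L ω * x ^ m = 0) :
    ∃ s : L, ∀ V : ValuationSubring L, (∀ c : K, algebraMap K L c ∈ V) → x ∉ V →
      1 < V.valuation s ∧ V.valuation x = V.valuation s ^ T.natDegree ∧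
        V.valuation y = V.valuation s ^ m := by
  -- The Bézout exponents do not depend on `V`, so a single `s` serves all places at infinity and
  -- allows them to be compared.
  refine ⟨x ^ T.natDegree.gcdA m * y ^ T.natDegree.gcdB m, fun V hV hx ↦ ?_⟩
  have := V.isTrivialOn_valuation hV
  have hT : T ≠ 0 := by rintro rfl; simp at hT0
  have hy : y ∉ V := mt (ValuationSubring.mem_iff_mem_of_aeval_add_eq_zero hV hω hm hxy hT0).mpr hx
  rw [← V.valuation_le_one_iff, not_le] at hx hy
  have hbez := Nat.gcd_eq_gcd_ab T.natDegree m
  rw [hcop] at hbez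
  push_cast at hbez
  exact V.valuation.eq_pow_of_pow_eq_pow (by linarith) hT0 hx
    (V.valuation.pow_eq_pow_of_aeval_add_eq_zero hω hxy hT hy)

/-- The value is a power of `γ > 1`. This one fact yields both the embedding of the coordinate ring
and the minimality of the equation of `y` over `K[X]`. -/
theorem aevalAeval_ne_zero_of_notMem {L : Type*} [Field L] [Algebra K L] (hω : ω ≠ 0)
    (hm : m ≠ 0) (hT0 : T.natDegree ≠ 0) (hcop : T.natDegree.Coprime m) {V : ValuationSubring L}
    (hV : ∀ c : K, algebraMap K L c ∈ V) {x y : L} (hx : x ∉ V)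
    (hxy : aeval y T + algebraMap K L ω * x ^ m = 0) {p : K[X][X]} (hp : p ≠ 0)
    (hpn : p.natDegree < T.natDegree) : aevalAeval x y p ≠ 0 := by
  have := V.isTrivialOn_valuation hV
  obtain ⟨s, hs⟩ := exists_forall_valuation_eq_pow hω hm hT0 hcop hxy
  obtain ⟨h1, h2, h3⟩ := hs V hV hx
  rw [← V.valuation.ne_zero_iff,
    V.valuation.map_aevalAeval_eq_pow_weightedDegree hcop h1 h2 h3 hp hpn]
  exact pow_ne_zero _ (zero_lt_one.trans h1).ne'

/-- The coordinate ring of `T(Y) + ω X ^ m = 0` embeds into a field with a valuation ring that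
contains `K` but not `x`. -/
theorem exists_injective_algHom_notMem (hω : ω ≠ 0) (hm : m ≠ 0) (hT : T.Monic)
    (hT0 : T.natDegree ≠ 0) (hcop : T.natDegree.Coprime m) :
    ∃ ψ : CoordinateRing (separatedCurve T ω m) →ₐ[K] AlgebraicClosure (RatFunc K),
      Function.Injective ψ ∧ ∃ V : ValuationSubring (AlgebraicClosure (RatFunc K)),
        (∀ c : K, algebraMap K _ c ∈ V) ∧ ψ (ringCoord _ 0) ∉ V := by
  let L := AlgebraicClosure (RatFunc K)
  let x : L := algebraMap (RatFunc K) L RatFunc.X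
  have hx : Transcendental K x :=
    (transcendental_algebraMap_iff (algebraMap (RatFunc K) L).injective).mpr
      RatFunc.transcendental_X
  obtain ⟨V, hV, hxV⟩ := hx.exists_valuationSubring_notMem
  -- A point of the curve with transcendental first coordinate `x`; `y` exists because `L` is
  -- algebraically closed.
  obtain ⟨y, hy⟩ : ∃ y : L, (T.map (algebraMap K L) + C (algebraMap K L ω * x ^ m)).IsRoot y := by
    refine IsAlgClosed.exists_root _ fun h ↦ hT0 ?_
    have := natDegree_eq_of_degree_eq_some h
    rwa [natDegree_add_C, natDegree_map] at this
  have hxy : aeval y T + algebraMap K L ω * x ^ m = 0 := by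
    simpa [IsRoot.def, eval_map_algebraMap] using hy
  have hf : ∀ a ∈ Ideal.span {separatedCurve T ω m}, MvPolynomial.aeval ![x, y] a = 0 := by
    intro a ha
    obtain ⟨b, rfl⟩ := Ideal.mem_span_singleton.mp ha
    rw [map_mul, separatedCurve, map_add, ← aeval_algHom_apply, map_mul, map_pow]
    simp [hxy]
  have hψ0 : Ideal.Quotient.liftₐ _ (MvPolynomial.aeval ![x, y]) hf (ringCoord _ 0) = x :=
    (MvPolynomial.aeval_X _ _).trans rfl
  have hψ1 : Ideal.Quotient.liftₐ _ (MvPolynomial.aeval ![x, y]) hf (ringCoord _ 1) = y :=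
    (MvPolynomial.aeval_X _ _).trans rfl
  refine ⟨Ideal.Quotient.liftₐ _ (MvPolynomial.aeval ![x, y]) hf, ?_, V, hV, ?_⟩
  · rw [injective_iff_map_eq_zero]
    intro a ha
    obtain ⟨p, hpn, rfl⟩ := exists_natDegree_lt_aevalAeval_ringCoord_eq hT hT0 a
    rw [map_aevalAeval, hψ0, hψ1] at ha
    by_contra hne
    refine aevalAeval_ne_zero_of_notMem hω hm hT0 hcop hV hxV hxy (fun h ↦ hne ?_) hpn ha
    rw [h, map_zero]
  · rwa [hψ0]

theorem isDomain_coordinateRing (hω : ω ≠ 0) (hm : m ≠ 0) (hT : T.Monic)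
    (hT0 : T.natDegree ≠ 0) (hcop : T.natDegree.Coprime m) :
    IsDomain (CoordinateRing (separatedCurve T ω m)) := by
  obtain ⟨ψ, hψ, -⟩ := exists_injective_algHom_notMem hω hm hT hT0 hcop
  exact hψ.isDomain ψ.toRingHom

/-- Over `K[X]`, the minimal polynomial of `y` is the curve's own equation, because no nonzero
polynomial of smaller `Y`-degree vanishes at `y`; its `Y`-derivative is `T' = 1`. -/
theorem isIntegrallyClosed_coordinateRing (hω : ω ≠ 0) (hm : m ≠ 0) (hT : T.Monic)
    (hT0 : T.natDegree ≠ 0) (hcop : T.natDegree.Coprime m) (hder : derivative T = 1)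
    [IsDomain (CoordinateRing (separatedCurve T ω m))] :
    IsIntegrallyClosed (CoordinateRing (separatedCurve T ω m)) := by
  obtain ⟨ψ, hψ, V, hV, hxV⟩ := exists_injective_algHom_notMem hω hm hT hT0 hcop
  let f := separatedCurve T ω m
  let : Algebra K[X] (CoordinateRing f) := (aeval (ringCoord f 0)).toRingHom.toAlgebra
  have haeval : ∀ p : K[X][X], aeval (ringCoord f 1) p =
      aevalAeval (ringCoord f 0) (ringCoord f 1) p := by
    intro p
    induction p using Polynomial.induction_on' with
    | add p q hp hq => rw [map_add, map_add, hp, hq]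
    | monomial n a =>
      rw [aeval_monomial, ← C_mul_X_pow_eq_monomial, map_mul, map_pow, aevalAeval_C, aevalAeval_Y]
      rfl
  have hrel : ∀ p : K[X][X], p ≠ 0 → p.natDegree < T.natDegree →
      aeval (ringCoord f 1) p ≠ 0 := by
    intro p hp hpn h
    rw [haeval] at h
    have h' := congrArg ψ h
    rw [map_aevalAeval, map_zero] at h'
    refine aevalAeval_ne_zero_of_notMem hω hm hT0 hcop hV hxV ?_ hp hpn h'
    have := congrArg ψ (ringCoord_relation (T := T) (ω := ω) (m := m))
    rwa [map_add, ← aeval_algHom_apply, map_mul, map_pow, AlgHom.commutes, map_zero] at this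
  have hmon := monic_bivariateSeparated (ω := ω) (m := m) hT hT0
  have hroot : aeval (ringCoord f 1) (bivariateSeparated T ω m) = 0 := by
    rw [haeval, aevalAeval_bivariateSeparated]
    exact ringCoord_relation
  have hmin : bivariateSeparated T ω m = minpoly K[X] (ringCoord f 1) := by
    refine minpoly.unique' _ _ hmon hroot fun p hp ↦ or_iff_not_imp_left.mpr fun hp0 ↦ ?_
    refine hrel p hp0 ?_
    rw [← natDegree_bivariateSeparated (ω := ω) (m := m)]
    exact natDegree_lt_natDegree hp0 hp
  have : FaithfulSMul K[X] (CoordinateRing f) := by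
    rw [faithfulSMul_iff_algebraMap_injective, injective_iff_map_eq_zero]
    intro a ha
    by_contra ha0
    refine hrel (C a) (by simpa using ha0) (by simpa using Nat.pos_of_ne_zero hT0) ?_
    rw [aeval_C, ha]
  refine IsIntegrallyClosed.of_adjoin_eq_top_of_derivative_eq_one (R := K[X])
    (y := ringCoord f 1) ⟨_, hmon, hroot⟩ ?_ ?_
  · rw [eq_top_iff]
    intro a _
    obtain ⟨p, rfl⟩ := exists_aevalAeval_ringCoord_eq f a
    rw [← haeval]
    exact aeval_mem_adjoin_singleton _ _
  · rw [← hmin, derivative_bivariateSeparated hder]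

end Separated

end PlaneCurve

/-! ### Local parameters and pole orders at a place -/

namespace Place

variable {K F : Type*} [Field K] [Field F] [Algebra K F]

theorem ext_ring {P Q : Place K F} (h : P.ring = Q.ring) : P = Q := by
  cases P; cases Q; cases h; rfl

theorem valuation_le_of_mem_span {V : ValuationSubring F} {a b : V}
    (h : a ∈ Ideal.span {b}) : V.valuation (a : F) ≤ V.valuation (b : F) := by
  obtain ⟨c, rfl⟩ := Ideal.mem_span_singleton.mp h
  rw [MulMemClass.coe_mul, map_mul]
  exact mul_le_of_le_one_right' (V.valuation_le_one c)

theorem isLocalParameter_inv {P : Place K F} {s : F} (hs : 1 < P.ring.valuation s)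
    (hgen : ∀ z : F, z ≠ 0 → ∃ k : ℤ, P.ring.valuation z = P.ring.valuation s ^ k) :
    P.IsLocalParameter s⁻¹ := by
  have hs0 : s ≠ 0 := by rintro rfl; simp at hs
  have hinv : P.ring.valuation s⁻¹ < 1 := by
    rw [map_inv₀]
    exact inv_lt_one_of_one_lt₀ hs
  refine ⟨(P.ring.valuation_le_one_iff _).mp hinv.le, le_antisymm (fun w hw ↦ ?_) ?_⟩
  · rw [ValuationSubring.valuation_lt_one_iff] at hw
    -- The value of `w` is `γ ^ k` with `γ` the value of `s` and `k < 0`; as `k` is an integer, `k +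
    -- 1 ≤ 0`.
    have hmem : s * w ∈ P.ring := by
      rw [← P.ring.valuation_le_one_iff]
      rcases eq_or_ne (w : F) 0 with h0 | h0
      · simp [h0]
      obtain ⟨k, hk⟩ := hgen w h0
      rw [hk] at hw
      rw [map_mul, hk, ← zpow_one_add₀ (zero_lt_one.trans hs).ne']
      rw [zpow_lt_one_iff_right₀ hs] at hw
      exact zpow_le_one_of_nonpos₀ hs.le (by omega)
    refine Ideal.mem_span_singleton.mpr ⟨⟨s * w, hmem⟩, Subtype.ext ?_⟩
    simp [hs0]
  · rw [Ideal.span_singleton_le_iff_mem, ValuationSubring.valuation_lt_one_iff]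
    exact hinv

/-- All local parameters generate the same ideal and so have the same value, that of `s⁻¹`; the
choice in `HasPoleOrder` is immaterial. -/
theorem hasPoleOrder_iff {P : Place K F} {s : F} (hs : 1 < P.ring.valuation s)
    (hgen : ∀ z : F, z ≠ 0 → ∃ k : ℤ, P.ring.valuation z = P.ring.valuation s ^ k)
    {z : F} {n : ℕ} : P.HasPoleOrder z n ↔ P.ring.valuation z = P.ring.valuation s ^ n := by
  have hpar := isLocalParameter_inv hs hgen
  have hval : ∀ t, P.IsLocalParameter t → P.ring.valuation t = (P.ring.valuation s)⁻¹ := by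
    rintro t ⟨ht, htmax⟩
    obtain ⟨hs', hsmax⟩ := hpar
    rw [← map_inv₀]
    refine le_antisymm
      (valuation_le_of_mem_span (a := ⟨t, ht⟩) (b := ⟨s⁻¹, hs'⟩) ?_)
      (valuation_le_of_mem_span (a := ⟨s⁻¹, hs'⟩) (b := ⟨t, ht⟩) ?_)
    · rw [← hsmax, htmax]
      exact Ideal.mem_span_singleton_self _
    · rw [← htmax, hsmax]
      exact Ideal.mem_span_singleton_self _
  have hs0 : P.ring.valuation s ^ n ≠ 0 := pow_ne_zero _ (zero_lt_one.trans hs).ne'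
  have key : ∀ t, P.IsLocalParameter t →
      (P.ring.valuation (z * t ^ n) = 1 ↔ P.ring.valuation z = P.ring.valuation s ^ n) := by
    intro t ht
    rw [map_mul, map_pow, hval t ht, inv_pow, mul_inv_eq_one₀ hs0]
  exact ⟨fun ⟨t, ht, h⟩ ↦ (key t ht).mp h, fun h ↦ ⟨_, hpar, (key _ hpar).mpr h⟩⟩

end Place

/-! ### The place at infinity and its Weierstrass semigroup -/

namespace PlaneCurve

section Separated

variable {K : Type*} [Field K] {T : K[X]} {ω : K} {m : ℕ}

local notation "crv" => separatedCurve T ω m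

theorem map_aevalAeval_ringCoord (f : MvPolynomial (Fin 2) K) (p : K[X][X]) :
    algebraMap (CoordinateRing f) (FunctionField f)
      (aevalAeval (ringCoord f 0) (ringCoord f 1) p) = aevalAeval (coord f 0) (coord f 1) p :=
  map_aevalAeval (IsScalarTower.toAlgHom K (CoordinateRing f) (FunctionField f)) _ _ p

theorem coord_relation : aeval (coord crv 1) T +
    algebraMap K (FunctionField crv) ω * coord crv 0 ^ m = 0 := by
  rw [← aevalAeval_bivariateSeparated, ← map_aevalAeval_ringCoord, aevalAeval_bivariateSeparated,
    ringCoord_relation, map_zero]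

variable [IsDomain (CoordinateRing (separatedCurve T ω m))]

theorem coord_mem_iff (hω : ω ≠ 0) (hm : m ≠ 0) (hT0 : T.natDegree ≠ 0)
    (Q : Place K (FunctionField crv)) : coord crv 0 ∈ Q.ring ↔ coord crv 1 ∈ Q.ring :=
  ValuationSubring.mem_iff_mem_of_aeval_add_eq_zero Q.algebraMap_mem hω hm coord_relation hT0

theorem exists_div_aevalAeval_coord_eq (hT : T.Monic) (hT0 : T.natDegree ≠ 0)
    (z : FunctionField crv) : ∃ p q : K[X][X], p.natDegree < T.natDegree ∧
      q.natDegree < T.natDegree ∧ q ≠ 0 ∧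
      aevalAeval (coord crv 0) (coord crv 1) p / aevalAeval (coord crv 0) (coord crv 1) q = z := by
  obtain ⟨a, b, hb, rfl⟩ := IsFractionRing.div_surjective (A := CoordinateRing crv) z
  obtain ⟨p, hp, rfl⟩ := exists_natDegree_lt_aevalAeval_ringCoord_eq hT hT0 a
  obtain ⟨q, hq, rfl⟩ := exists_natDegree_lt_aevalAeval_ringCoord_eq hT hT0 b
  refine ⟨p, q, hp, hq, ?_, ?_⟩
  · rintro rfl
    simp at hb
  · rw [map_aevalAeval_ringCoord, map_aevalAeval_ringCoord]

/-- Every function is a quotient of two reduced polynomials. At a pole of `x`, its regularity is a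
comparison of their weighted degrees, which does not involve the place. -/
theorem place_eq_of_coord_notMem (hω : ω ≠ 0) (hm : m ≠ 0) (hT : T.Monic)
    (hT0 : T.natDegree ≠ 0) (hcop : T.natDegree.Coprime m) {P Q : Place K (FunctionField crv)}
    (hP : coord crv 0 ∉ P.ring) (hQ : coord crv 0 ∉ Q.ring) : P = Q := by
  obtain ⟨s, hs⟩ := exists_forall_valuation_eq_pow hω hm hT0 hcop
    (coord_relation (T := T) (ω := ω) (m := m))
  refine Place.ext_ring (ValuationSubring.ext _ _ fun z ↦ ?_)
  obtain ⟨p, q, hp, hq, hq0, rfl⟩ := exists_div_aevalAeval_coord_eq hT hT0 z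
  rcases eq_or_ne p 0 with rfl | hp0
  · simp [zero_mem]
  have key : ∀ R : Place K (FunctionField crv), coord crv 0 ∉ R.ring →
      (aevalAeval (coord crv 0) (coord crv 1) p / aevalAeval (coord crv 0) (coord crv 1) q ∈ R.ring
        ↔ p.weightedDegree T.natDegree m ≤ q.weightedDegree T.natDegree m) := by
    intro R hR
    have := R.ring.isTrivialOn_valuation R.algebraMap_mem
    obtain ⟨h1, h2, h3⟩ := hs R.ring R.algebraMap_mem hR
    rw [← R.ring.valuation_le_one_iff, map_div₀,
      R.ring.valuation.map_aevalAeval_eq_pow_weightedDegree hcop h1 h2 h3 hp0 hp,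
      R.ring.valuation.map_aevalAeval_eq_pow_weightedDegree hcop h1 h2 h3 hq0 hq,
      div_le_one₀ (pow_pos (zero_lt_one.trans h1) _), pow_le_pow_iff_right₀ h1]
  rw [key P hP, key Q hQ]

theorem exists_place_coord_notMem (hω : ω ≠ 0) (hm : m ≠ 0) (hT : T.Monic)
    (hT0 : T.natDegree ≠ 0) (hcop : T.natDegree.Coprime m) :
    ∃ P : Place K (FunctionField crv), coord crv 0 ∉ P.ring := by
  obtain ⟨ψ, hψ, V, hV, hxV⟩ := exists_injective_algHom_notMem hω hm hT hT0 hcop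
  let φ : FunctionField crv →+* AlgebraicClosure (RatFunc K) :=
    IsFractionRing.lift (g := ψ.toRingHom) hψ
  have hφ : ∀ a, φ (algebraMap (CoordinateRing crv) _ a) = ψ a := fun a ↦
    IsFractionRing.lift_algebraMap (g := ψ.toRingHom) hψ a
  have hx : coord crv 0 ∉ V.comap φ := by
    rw [ValuationSubring.mem_comap, ← algebraMap_ringCoord, hφ]
    exact hxV
  refine ⟨⟨V.comap φ, fun c ↦ ?_, fun h ↦ ?_⟩, hx⟩
  · rw [ValuationSubring.mem_comap, IsScalarTower.algebraMap_apply K (CoordinateRing crv), hφ,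
      AlgHom.commutes]
    exact hV c
  · rw [h] at hx
    exact hx (ValuationSubring.mem_top _)

/-- The functions regular at all places other than the place at infinity are the elements of the
coordinate ring. -/
theorem forall_mem_ring_iff (hω : ω ≠ 0) (hm : m ≠ 0) (hT : T.Monic)
    (hT0 : T.natDegree ≠ 0) (hcop : T.natDegree.Coprime m) (hder : derivative T = 1)
    {P : Place K (FunctionField crv)} (hP : coord crv 0 ∉ P.ring) (z : FunctionField crv) :
    (∀ Q : Place K (FunctionField crv), Q ≠ P → z ∈ Q.ring) ↔
      ∃ a : CoordinateRing crv, algebraMap _ _ a = z := by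
  have hcoord : ∀ V : ValuationSubring (FunctionField crv),
      (∀ c : K, algebraMap K _ c ∈ V) → coord crv 0 ∈ V → coord crv 1 ∈ V →
      ∀ a : CoordinateRing crv, algebraMap _ _ a ∈ V := by
    intro V hV hx hy a
    obtain ⟨b, rfl⟩ := Ideal.Quotient.mkₐ_surjective K _ a
    induction b using MvPolynomial.induction_on with
    | C c => exact hV c
    | add p q hp hq =>
      rw [map_add, map_add]
      exact add_mem hp hq
    | mul_X p i hp =>
      rw [map_mul, map_mul]
      refine mul_mem hp ?_
      fin_cases i
      · exact hx
      · exact hy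
  constructor
  · intro h
    by_contra hz
    have := isIntegrallyClosed_coordinateRing hω hm hT hT0 hcop hder
    -- Integral closedness is carried to the image of the coordinate ring by lifting monic
    -- equations. A function `z` outside this image is then excluded by a valuation ring above it;
    -- that ring contains `x`, so it is a place other than `P`.
    have : IsIntegrallyClosedIn (algebraMap (CoordinateRing crv) (FunctionField crv)).range
        (FunctionField crv) := by
      rw [Subring.isIntegrallyClosedIn_iff]
      intro w hw
      obtain ⟨a, ha⟩ := (isIntegrallyClosed_iff (R := CoordinateRing crv) (FunctionField crv)).mp
        this (x := w) (by
          obtain ⟨p, hp, hp0⟩ := hw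
          obtain ⟨p', hp', -, hmon⟩ := lifts_and_natDegree_eq_and_monic
            (f := (algebraMap (CoordinateRing crv) (FunctionField crv)).rangeRestrict) (p := p)
            (mem_lifts_of_surjective (RingHom.rangeRestrict_surjective _) p) hp
          refine ⟨p', hmon, ?_⟩
          rw [← hp', eval₂_map] at hp0
          exact hp0)
      exact ⟨a, ha⟩
    obtain ⟨V, hV, hzV⟩ := Subring.exists_le_valuationSubring_of_isIntegrallyClosedIn
      (R := (algebraMap (CoordinateRing crv) (FunctionField crv)).range) (x := z) hz
    refine hzV (h ⟨V, fun c ↦ hV ⟨algebraMap K _ c, rfl⟩, ?_⟩ ?_)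
    · rintro rfl
      exact hzV (ValuationSubring.mem_top _)
    · rintro rfl
      exact hP (hV ⟨ringCoord _ 0, rfl⟩)
  · rintro ⟨a, rfl⟩ Q hQ
    have hx : coord crv 0 ∈ Q.ring := by
      by_contra hx
      exact hQ (place_eq_of_coord_notMem hω hm hT hT0 hcop hx hP)
    exact hcoord Q.ring Q.algebraMap_mem hx ((coord_mem_iff hω hm hT0 Q).mp hx) a

theorem weierstrassSemigroup_eq (hω : ω ≠ 0) (hm : m ≠ 0) (hT : T.Monic)
    (hT0 : T.natDegree ≠ 0) (hcop : T.natDegree.Coprime m) (hder : derivative T = 1)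
    {P : Place K (FunctionField crv)} (hP : coord crv 0 ∉ P.ring) :
    P.weierstrassSemigroup = (AddSubmonoid.closure {T.natDegree, m} : AddSubmonoid ℕ) := by
  obtain ⟨s, hs⟩ := exists_forall_valuation_eq_pow hω hm hT0 hcop
    (coord_relation (T := T) (ω := ω) (m := m))
  obtain ⟨h1, h2, h3⟩ := hs P.ring P.algebraMap_mem hP
  have := P.ring.isTrivialOn_valuation P.algebraMap_mem
  have hval : ∀ p : K[X][X], p ≠ 0 → p.natDegree < T.natDegree →
      P.ring.valuation (aevalAeval (coord crv 0) (coord crv 1) p) =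
        P.ring.valuation s ^ p.weightedDegree T.natDegree m := fun p hp hpn ↦
    P.ring.valuation.map_aevalAeval_eq_pow_weightedDegree hcop h1 h2 h3 hp hpn
  have hs0 : P.ring.valuation s ≠ 0 := (zero_lt_one.trans h1).ne'
  have hgen : ∀ z : FunctionField crv, z ≠ 0 →
      ∃ k : ℤ, P.ring.valuation z = P.ring.valuation s ^ k := by
    intro z hz
    obtain ⟨p, q, hp, hq, hq0, rfl⟩ := exists_div_aevalAeval_coord_eq hT hT0 z
    have hp0 : p ≠ 0 := by rintro rfl; simp at hz
    refine ⟨p.weightedDegree T.natDegree m - q.weightedDegree T.natDegree m, ?_⟩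
    rw [map_div₀, hval p hp0 hp, hval q hq0 hq, zpow_sub₀ hs0, zpow_natCast, zpow_natCast]
  ext k
  simp only [Place.weierstrassSemigroup, Set.mem_ofPred_eq, SetLike.mem_coe,
    forall_mem_ring_iff hω hm hT hT0 hcop hder hP, Place.hasPoleOrder_iff h1 hgen]
  constructor
  · rintro ⟨_, ⟨a, rfl⟩, hk⟩
    obtain ⟨p, hp, rfl⟩ := exists_natDegree_lt_aevalAeval_ringCoord_eq hT hT0 a
    rw [map_aevalAeval_ringCoord] at hk
    have hp0 : p ≠ 0 := by
      rintro rfl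
      rw [map_zero, map_zero] at hk
      exact pow_ne_zero _ hs0 hk.symm
    rw [hval p hp0 hp, (pow_right_injective₀ (zero_lt_one.trans h1) h1.ne').eq_iff] at hk
    exact hk ▸ p.weightedDegree_mem_closure _ _
  · rw [AddSubmonoid.mem_closure_pair]
    rintro ⟨i, j, rfl⟩
    -- `x` has pole order `n = deg T` and `y` has pole order `m`.
    refine ⟨coord crv 0 ^ i * coord crv 1 ^ j, ⟨ringCoord _ 0 ^ i * ringCoord _ 1 ^ j, ?_⟩, ?_⟩
    · rw [map_mul, map_pow, map_pow, algebraMap_ringCoord, algebraMap_ringCoord]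
    · rw [map_mul, map_pow, map_pow, h2, h3, ← pow_mul, ← pow_mul, ← pow_add, smul_eq_mul,
        smul_eq_mul, mul_comm i, mul_comm j]

end Separated

end PlaneCurve

/-! ### The point at infinity and the centre of the place -/

namespace PlaneCurve

section Separated

variable {K : Type*} [Field K]

/-- At a point of the line at infinity, the homogenization of `f` takes the value of the top
homogeneous component of `f`. -/
theorem eval_homogenization_of_eq_zero (f : MvPolynomial (Fin 2) K) {w : Fin 3 → K}
    (hw : w 2 = 0) : MvPolynomial.eval w (homogenization f) =
      MvPolynomial.eval ![w 0, w 1] (MvPolynomial.homogeneousComponent f.totalDegree f) := by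
  have hw' : w ∘ Fin.castSucc = ![w 0, w 1] := by
    ext i
    fin_cases i <;> rfl
  rw [homogenization, map_sum, Finset.sum_range_succ, Finset.sum_eq_zero, zero_add]
  · simp [MvPolynomial.eval_rename, hw']
  · intro i hi
    have : f.totalDegree - i ≠ 0 := by
      have := Finset.mem_range.mp hi
      omega
    simp [hw, this]

theorem homogeneousComponent_separatedCurve (T : K[X]) (ω : K) (m N : ℕ) :
    MvPolynomial.homogeneousComponent N (separatedCurve T ω m) =
      MvPolynomial.C (T.coeff N) * MvPolynomial.X 1 ^ N +
        if m = N then MvPolynomial.C ω * MvPolynomial.X 0 ^ m else 0 := by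
  have hpow : ∀ (i : Fin 2) (j : ℕ), MvPolynomial.homogeneousComponent N
      (MvPolynomial.X i ^ j : MvPolynomial (Fin 2) K) =
        if j = N then MvPolynomial.X i ^ j else 0 := fun i j ↦
    (MvPolynomial.homogeneousComponent_of_mem ((MvPolynomial.mem_homogeneousSubmodule _ _).mpr
      (MvPolynomial.isHomogeneous_X_pow i j))).trans (if_congr eq_comm rfl rfl)
  rw [separatedCurve, map_add, MvPolynomial.homogeneousComponent_C_mul, hpow, mul_ite, mul_zero]
  congr 1
  rw [aeval_eq_sum_range' (n := max T.natDegree N + 1) (by omega), map_sum]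
  simp only [map_smul, hpow, smul_ite, smul_zero]
  rw [Finset.sum_ite_eq_of_mem' _ _ _ (by simp), MvPolynomial.smul_eq_C_mul]

theorem totalDegree_separatedCurve {T : K[X]} {ω : K} {m : ℕ} (hω : ω ≠ 0) (hT : T.Monic)
    (hT0 : T.natDegree ≠ 0) : (separatedCurve T ω m).totalDegree = max T.natDegree m := by
  refine le_antisymm ?_ ?_
  · refine (MvPolynomial.totalDegree_add _ _).trans (max_le_max ?_ ?_)
    · rw [aeval_eq_sum_range]
      refine (MvPolynomial.totalDegree_finsetSum _ _).trans (Finset.sup_le fun i hi ↦ ?_)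
      refine (MvPolynomial.totalDegree_smul_le _ _).trans ?_
      rw [MvPolynomial.totalDegree_X_pow]
      exact Nat.lt_succ_iff.mp (Finset.mem_range.mp hi)
    · refine (MvPolynomial.totalDegree_mul _ _).trans ?_
      rw [MvPolynomial.totalDegree_C, MvPolynomial.totalDegree_X_pow, zero_add]
  · by_contra! hlt
    have h0 := MvPolynomial.homogeneousComponent_eq_zero _ _ hlt
    rw [homogeneousComponent_separatedCurve] at h0
    rcases lt_or_ge T.natDegree m with h | h
    · have := congrArg (MvPolynomial.eval ![1, 0]) h0
      rw [max_eq_right h.le, coeff_eq_zero_of_natDegree_lt h] at this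
      simp [hω] at this
    · have := congrArg (MvPolynomial.eval ![0, 1]) h0
      rw [max_eq_left h, hT.coeff_natDegree] at this
      split_ifs at this with hm
      · subst hm
        simp [hT0] at this
      · simp at this

variable {T : K[X]} {ω : K} {m : ℕ}

local notation "crv" => separatedCurve T ω m

/-- If the nonzero vectors `(u : w : 0)` on which the homogenization vanishes are the multiples
of one of them, then that vector is the unique point at infinity; it is the centre of the place at
infinity as soon as the functions `c x - u`, `c y - w` and `c` vanish there for some `c`. -/
theorem hasWeierstrassSemigroupAtInfinity_of_point (hω : ω ≠ 0) (hm : m ≠ 0) (hT : T.Monic)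
    (hT0 : T.natDegree ≠ 0) (hcop : T.natDegree.Coprime m) (hder : derivative T = 1)
    {u w : K} (huw : ![u, w, 0] ≠ 0)
    (hpt : ∀ a b : K, MvPolynomial.eval ![a, b]
      (MvPolynomial.homogeneousComponent (max T.natDegree m) crv) = 0 ↔ ∃ c, a = c * u ∧ b = c * w)
    (hcentre : ∀ [IsDomain (CoordinateRing crv)] (P : Place K (FunctionField crv)),
      coord crv 0 ∉ P.ring → ∃ c : FunctionField crv,
        P.ring.valuation (c * coord crv 0 - algebraMap K _ u) < 1 ∧
        P.ring.valuation (c * coord crv 1 - algebraMap K _ w) < 1 ∧ P.ring.valuation c < 1) :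
    HasWeierstrassSemigroupAtInfinity crv (AddSubmonoid.closure {T.natDegree, m}) := by
  have hdom := isDomain_coordinateRing hω hm hT hT0 hcop
  obtain ⟨P, hP⟩ := exists_place_coord_notMem hω hm hT hT0 hcop
  -- The chosen representative of the point is only a unit multiple `l` of `(u, w, 0)`; `l` rescales
  -- the multiplier `c` below.
  obtain ⟨l, hl⟩ := Projectivization.exists_smul_eq_mk_rep K _ huw
  have hl0 : l • u = (Projectivization.mk K _ huw).rep 0 := congrFun hl 0
  have hl1 : l • w = (Projectivization.mk K _ huw).rep 1 := congrFun hl 1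
  have hl2 : 0 = (Projectivization.mk K _ huw).rep 2 := by
    rw [← hl]
    simp
  refine ⟨hdom, Projectivization.mk K _ huw, fun pt ↦ ?_, P, fun Q ↦ ?_,
    weierstrassSemigroup_eq hω hm hT hT0 hcop hder hP⟩
  · rw [IsPointAtInfinity, and_comm]
    constructor
    · rintro ⟨h2, h0⟩
      rw [eval_homogenization_of_eq_zero _ h2, totalDegree_separatedCurve hω hT hT0, hpt] at h0
      obtain ⟨c, hc0, hc1⟩ := h0
      rw [← pt.mk_rep, Projectivization.mk_eq_mk_iff']
      refine ⟨c, ?_⟩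
      ext i
      fin_cases i
      · exact hc0.symm
      · exact hc1.symm
      · simpa using h2.symm
    · rintro rfl
      refine ⟨hl2.symm, ?_⟩
      rw [eval_homogenization_of_eq_zero _ hl2.symm, totalDegree_separatedCurve hω hT hT0, hpt]
      exact ⟨l, hl0.symm, hl1.symm⟩
  · constructor
    · rintro ⟨c, hc⟩
      -- If `x`, hence `y`, were regular at `Q`, then `c`, `c x` and `c y` would all vanish there,
      -- and the centre would have only zero coordinates.
      refine place_eq_of_coord_notMem hω hm hT hT0 hcop (fun hx ↦ ?_) hP
      have hy := (coord_mem_iff hω hm hT0 Q).mp hx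
      have := Q.ring.isTrivialOn_valuation Q.algebraMap_mem
      have hc2 : Q.ring.valuation c < 1 := by
        have := hc 2
        rw [← hl2] at this
        simpa using this
      have hzero : ∀ (z : FunctionField crv) (a : K), z ∈ Q.ring →
          Q.ring.valuation (c * z - algebraMap K _ a) < 1 → a = 0 := by
        intro z a hz h
        by_contra ha
        have hcz : Q.ring.valuation (c * z) < 1 := by
          rw [map_mul]
          exact (mul_le_of_le_one_right' ((Q.ring.valuation_le_one_iff z).mpr hz)).trans_lt hc2
        have h1 := Q.ring.valuation.map_sub_lt hcz h
        rw [sub_sub_cancel, Valuation.IsTrivialOn.eq_one a ha] at h1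
        exact lt_irrefl _ h1
      refine (Projectivization.mk K _ huw).rep_nonzero ?_
      ext i
      fin_cases i
      · exact hzero _ _ hx (hc 0)
      · exact hzero _ _ hy (hc 1)
      · exact hl2.symm
    · rintro rfl
      have := Q.ring.isTrivialOn_valuation Q.algebraMap_mem
      obtain ⟨c, hc0, hc1, hc2⟩ := hcentre Q hP
      have hval : Q.ring.valuation (algebraMap K _ (l : K)) = 1 :=
        Valuation.IsTrivialOn.eq_one _ l.ne_zero
      have hscale : ∀ (z : FunctionField crv) (a : K),
          Q.ring.valuation (c * z - algebraMap K _ a) < 1 →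
          Q.ring.valuation (algebraMap K _ (l : K) * c * z - algebraMap K _ (l • a)) < 1 := by
        intro z a h
        rwa [Units.smul_def, smul_eq_mul, map_mul, mul_assoc, ← mul_sub, map_mul, hval, one_mul]
      refine ⟨algebraMap K _ (l : K) * c, fun i ↦ ?_⟩
      fin_cases i
      · have := hscale _ _ hc0
        rwa [hl0] at this
      · have := hscale _ _ hc1
        rwa [hl1] at this
      · have := hscale 1 0 (by simpa using hc2)
        rwa [smul_zero, hl2] at this

/-- The Weierstrass semigroup at infinity of `T(Y) + ω X ^ m = 0`, where `T` has derivative `1` and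
`m` is coprime to the degree of `T`. -/
theorem hasWeierstrassSemigroupAtInfinity_separatedCurve (hω : ω ≠ 0) (hm : m ≠ 0) (hT : T.Monic)
    (hT0 : T.natDegree ≠ 0) (hcop : T.natDegree.Coprime m) (hder : derivative T = 1)
    (hT1 : T.natDegree = 1 → T = X) :
    HasWeierstrassSemigroupAtInfinity crv (AddSubmonoid.closure {T.natDegree, m}) := by
  have hlt : ∀ [IsDomain (CoordinateRing crv)] (P : Place K (FunctionField crv)),
      coord crv 0 ∉ P.ring → (1 < P.ring.valuation (coord crv 0)) ∧
      (1 < P.ring.valuation (coord crv 1)) ∧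
      (T.natDegree < m → P.ring.valuation (coord crv 0) < P.ring.valuation (coord crv 1)) ∧
      (m < T.natDegree → P.ring.valuation (coord crv 1) < P.ring.valuation (coord crv 0)) := by
    intro _ P hP
    obtain ⟨s, hs⟩ := exists_forall_valuation_eq_pow hω hm hT0 hcop
      (coord_relation (T := T) (ω := ω) (m := m))
    obtain ⟨h1, h2, h3⟩ := hs P.ring P.algebraMap_mem hP
    rw [h2, h3]
    exact ⟨one_lt_pow₀ h1 hT0, one_lt_pow₀ h1 hm, fun h ↦ pow_lt_pow_right₀ h1 h,
      fun h ↦ pow_lt_pow_right₀ h1 h⟩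
  rcases lt_trichotomy T.natDegree m with h | h | h
  -- The top component is `ω X ^ m` and `y` has the larger pole, so the point is `(0 : 1 : 0)` and
  -- `c = y⁻¹`.
  · refine hasWeierstrassSemigroupAtInfinity_of_point hω hm hT hT0 hcop hder (u := 0) (w := 1)
      (fun h0 ↦ by simpa using congrFun h0 1) (fun a b ↦ ?_) fun P hP ↦ ?_
    · rw [max_eq_right h.le, homogeneousComponent_separatedCurve, coeff_eq_zero_of_natDegree_lt h]
      simp [hω, hm]
    · obtain ⟨hx, hy, hxy, -⟩ := hlt P hP
      have hy0 : coord crv 1 ≠ 0 := by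
        intro h0
        simp [h0] at hy
      refine ⟨(coord crv 1)⁻¹, ?_, ?_, ?_⟩
      · rw [map_zero, sub_zero, map_mul, map_inv₀, inv_mul_lt_one₀ (zero_lt_one.trans hy)]
        exact hxy h
      · rw [inv_mul_cancel₀ hy0, map_one, sub_self, map_zero]
        exact zero_lt_one
      · rw [map_inv₀]
        exact inv_lt_one_of_one_lt₀ hy
  -- Equal coprime degrees are both `1`: the curve is the line `Y + ω X = 0`, with point `(1 : -ω :
  -- 0)`.
  · have hn : T.natDegree = 1 := by rwa [← h, Nat.coprime_self] at hcop
    have hm1 : m = 1 := h ▸ hn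
    refine hasWeierstrassSemigroupAtInfinity_of_point hω hm hT hT0 hcop hder (u := 1) (w := -ω)
      (fun h0 ↦ by simpa using congrFun h0 0) (fun a b ↦ ?_) fun P hP ↦ ?_
    · rw [homogeneousComponent_separatedCurve, hn, hm1, hT1 hn]
      simp only [max_self, coeff_X_one, if_true, map_add, map_mul, MvPolynomial.eval_C,
        MvPolynomial.eval_X, pow_one]
      constructor
      · intro h0
        refine ⟨a, (mul_one a).symm, ?_⟩
        simp at h0
        linear_combination h0
      · rintro ⟨c, rfl, rfl⟩
        simp
        ring
    · obtain ⟨hx, -⟩ := hlt P hP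
      have hx0 : coord crv 0 ≠ 0 := by
        intro h0
        simp [h0] at hx
      have hrel := coord_relation (T := T) (ω := ω) (m := m)
      have hrel' : coord crv 1 = - algebraMap K _ ω * coord crv 0 := by
        have e : aeval (coord crv 1) T = coord crv 1 := by
          conv_lhs => rw [aeval_def]; enter [3]; rw [hT1 hn]
          simp
        have e' : coord crv 0 ^ m = coord crv 0 := by
          conv_lhs => enter [2]; rw [hm1]
          simp
        rw [e, e'] at hrel
        linear_combination hrel
      refine ⟨(coord crv 0)⁻¹, ?_, ?_, ?_⟩
      · rw [inv_mul_cancel₀ hx0, map_one, sub_self, map_zero]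
        exact zero_lt_one
      · have : (coord crv 0)⁻¹ * coord crv 1 - algebraMap K _ (-ω) = 0 := by
          rw [hrel', map_neg]
          field_simp
          ring
        rw [this, map_zero]
        exact zero_lt_one
      · rw [map_inv₀]
        exact inv_lt_one_of_one_lt₀ hx
  -- The top component is `Y ^ n` with `n = deg T`, and `x` has the larger pole, so the point is `(1
  -- : 0 : 0)` and `c = x⁻¹`.
  · refine hasWeierstrassSemigroupAtInfinity_of_point hω hm hT hT0 hcop hder (u := 1) (w := 0)
      (fun h0 ↦ by simpa using congrFun h0 0) (fun a b ↦ ?_) fun P hP ↦ ?_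
    · rw [max_eq_left h.le, homogeneousComponent_separatedCurve, hT.coeff_natDegree]
      simp [h.ne, hT0]
    · obtain ⟨hx, -, -, hxy⟩ := hlt P hP
      have hx0 : coord crv 0 ≠ 0 := by
        intro h0
        simp [h0] at hx
      refine ⟨(coord crv 0)⁻¹, ?_, ?_, ?_⟩
      · rw [inv_mul_cancel₀ hx0, map_one, sub_self, map_zero]
        exact zero_lt_one
      · rw [map_zero, sub_zero, map_mul, map_inv₀, inv_mul_lt_one₀ (zero_lt_one.trans hx)]
        exact hxy h
      · rw [map_inv₀]
        exact inv_lt_one_of_one_lt₀ hx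

end Separated

/-! ### The trace polynomial -/

section Trace

variable {K : Type*} [Field K]

/-- The polynomial `∑_{i=1}^h X^{q/p^i}`, where `q = p^h`. -/
noncomputable def tracePolynomial (K : Type*) [Field K] (p h : ℕ) : K[X] :=
  ∑ i ∈ Finset.Icc 1 h, X ^ (p ^ h / p ^ i)

theorem traceCurve_eq_separatedCurve (p h : ℕ) (ω : K) (m : ℕ) :
    traceCurve p h ω m = separatedCurve (tracePolynomial K p h) ω m := by
  simp [traceCurve, separatedCurve, tracePolynomial]

theorem tracePolynomial_succ {p : ℕ} (hp : p ≠ 0) (h : ℕ) :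
    tracePolynomial K p (h + 1) = ∑ i ∈ Finset.range (h + 1), X ^ p ^ i := by
  rw [← Finset.sum_range_reflect, tracePolynomial, ← Finset.Ico_add_one_right_eq_Icc,
    Finset.sum_Ico_eq_sum_range]
  refine Finset.sum_congr rfl fun i hi ↦ ?_
  have := Finset.mem_range.mp hi
  rw [Nat.pow_div (by omega) (Nat.pos_of_ne_zero hp)]
  congr 2
  omega

theorem natDegree_tracePolynomial_succ {p : ℕ} (hp : 1 < p) (h : ℕ) :
    (tracePolynomial K p (h + 1)).natDegree = p ^ h ∧ (tracePolynomial K p (h + 1)).Monic := by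
  rw [tracePolynomial_succ (by omega), Finset.sum_range_succ, add_comm]
  have hlt : (∑ i ∈ Finset.range h, (X : K[X]) ^ p ^ i).degree < ((X : K[X]) ^ p ^ h).degree := by
    refine (degree_sum_le _ _).trans_lt ?_
    rw [degree_X_pow, Finset.sup_lt_iff (WithBot.bot_lt_coe _)]
    intro i hi
    rw [degree_X_pow]
    exact_mod_cast Nat.pow_lt_pow_right hp (Finset.mem_range.mp hi)
  exact ⟨by rw [natDegree_add_eq_left_of_degree_lt hlt, natDegree_X_pow],
    (monic_X_pow _).add_of_left hlt⟩

theorem derivative_tracePolynomial_succ {p : ℕ} [Fact p.Prime] [CharP K p] (h : ℕ) :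
    derivative (tracePolynomial K p (h + 1)) = 1 := by
  rw [tracePolynomial_succ (Fact.out : p.Prime).ne_zero, Finset.sum_range_succ', derivative_add,
    derivative_sum, Finset.sum_eq_zero, zero_add, pow_zero, pow_one, derivative_X]
  intro i _
  rw [derivative_X_pow, Nat.cast_pow, CharP.cast_eq_zero, zero_pow i.succ_ne_zero, map_zero,
    zero_mul]

theorem hasWeierstrassSemigroupAtInfinity_traceCurve {p h m : ℕ} [Fact p.Prime] [CharP K p]
    (hh : 1 ≤ h) {ω : K} (hω : ω ≠ 0) (hm : m ∣ p ^ h + 1) :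
    HasWeierstrassSemigroupAtInfinity (traceCurve p h ω m)
      (AddSubmonoid.closure {p ^ h / p, m}) := by
  -- From here `q = p ^ (h + 1)`, so the degree `q / p` is `p ^ h`; it equals `1` exactly when the
  -- new `h` is `0`, and then the trace polynomial is `X`.
  obtain ⟨h, rfl⟩ := Nat.exists_eq_add_of_le' hh
  have hp : p.Prime := Fact.out
  obtain ⟨hdeg, hmon⟩ := natDegree_tracePolynomial_succ (K := K) hp.one_lt h
  have hcop : (p ^ (h + 1)).Coprime m :=
    Nat.Coprime.coprime_dvd_right hm (by simp)
  rw [traceCurve_eq_separatedCurve, pow_succ, Nat.mul_div_cancel _ hp.pos, ← hdeg]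
  refine hasWeierstrassSemigroupAtInfinity_separatedCurve hω ?_ hmon ?_ ?_
    (derivative_tracePolynomial_succ h) ?_
  · rintro rfl
    simp at hm
  · rw [hdeg]
    exact pow_ne_zero _ hp.ne_zero
  · rw [hdeg]
    exact hcop.coprime_dvd_left (pow_dvd_pow p h.le_succ)
  · intro h1
    rw [hdeg, Nat.pow_eq_one] at h1
    obtain rfl := h1.resolve_left hp.ne_one
    simp [tracePolynomial_succ hp.ne_zero]

end Trace

end PlaneCurve

theorem mainTheorem3 {K : Type*} [Field K] (p : ℕ) [Fact p.Prime] [CharP K p]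
    (h q : ℕ) (hh : 1 ≤ h) (hq : q = p ^ h) (ω : K) (hω : ω ^ (q - 1) = -1) :
    (2 ≤ h →
      PlaneCurve.HasWeierstrassSemigroupAtInfinity
        (PlaneCurve.traceCurve p h ω (q + 1))
        (AddSubmonoid.closure {q / p, q + 1})) ∧
    (∀ d : ℕ, d ∣ q + 1 →
      PlaneCurve.HasWeierstrassSemigroupAtInfinity
        (PlaneCurve.traceCurve p h ω ((q + 1) / d))
        (AddSubmonoid.closure {q / p, (q + 1) / d})) := by
  -- A positive exponent is needed to conclude `ω ≠ 0`, as `0 ^ 0 = 1` could equal `-1` in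
  -- characteristic `2`.
  have hq1 : q - 1 ≠ 0 := by
    have := Nat.one_lt_pow (by omega : h ≠ 0) (Fact.out : p.Prime).one_lt
    omega
  have hω0 : ω ≠ 0 := by
    rintro rfl
    simp [zero_pow hq1] at hω
  subst hq
  exact ⟨fun _ ↦ PlaneCurve.hasWeierstrassSemigroupAtInfinity_traceCurve hh hω0 dvd_rfl,
    fun _ hd ↦ PlaneCurve.hasWeierstrassSemigroupAtInfinity_traceCurve hh hω0
      (Nat.div_dvd_of_dvd hd)⟩
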